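/- Let $A$ be a finite alphabet, let $A^*$ be the free monoid on $A$, let $\$$ be a symbol not in $A$, and put $A_\$=(A\times A)\cup(A\times\{\$\})\cup(\{\$\}\times A)$. For $u,v\in A^*$, the convolution $u\diamond v\in A_\$^*$ is the word of length $\max(|u|,|v|)$ obtained by reading $u$ and $v$ in parallel, the shorter one being padded at its end with the symbol $\$$. A group $G$ is called biautomatic if there are a finite alphabet $A$, a surjective monoid homomorphism $\pi\colon A^*\to G$ and a rational (that is, regular) language $L\subseteq A^*$ with $\pi(L)=G$ such that, for every $g\in\pi(A)\cup\{1\}$, both languages \[ \{u\diamond v\mid u,v\in L,\ \pi(v)=\pi(u)g\}\qquad\text{and}\qquad \{u\diamond v\mid u,v\in L,\ \pi(v)=g\,\pi(u)\} \] over $A_\$$ are recognized by finite state automata. Let $G$ be a biautomatic group and let $S$ be a finite subset of $G$. Then the centralizer \[ C_G(S)=\{g\in G\mid gs=sg\ \text{for all } s\in S\} \] is a biautomatic group. -/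

import Mathlib

/-- The padded two-tape alphabet `A_$ = (A × A) ∪ (A × {$}) ∪ ({$} × A)`, where the padding symbol
`$` does not belong to `A`. -/
inductive PaddedLetter (A : Type*) : Type _
  /-- the letter `(a, b)` -/
  | both (a b : A) : PaddedLetter A
  /-- the letter `(a, $)` -/
  | left (a : A) : PaddedLetter A
  /-- the letter `($, b)` -/
  | right (b : A) : PaddedLetter A

/-- The convolution `u ⋄ v` of two words: they are read in parallel, and the shorter one is padded
at its end by `$`. -/
def convolution {A : Type*} : List A → List A → List (PaddedLetter A)
  | [], [] => []
  | a :: u, [] => PaddedLetter.left a :: convolution u []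
  | [], b :: v => PaddedLetter.right b :: convolution [] v
  | a :: u, b :: v => PaddedLetter.both a b :: convolution u v

/-- The language `{u ⋄ v | u, v ∈ L, π v = π u * g}`. -/
def rightMultiplierLanguage {A G : Type*} [Group G] (π : FreeMonoid A →* G) (L : Language A)
    (g : G) : Language (PaddedLetter A) :=
  {w | ∃ u ∈ L, ∃ v ∈ L,
    π (FreeMonoid.ofList v) = π (FreeMonoid.ofList u) * g ∧ w = convolution u v}

/-- The language `{u ⋄ v | u, v ∈ L, π v = g * π u}`. -/
def leftMultiplierLanguage {A G : Type*} [Group G] (π : FreeMonoid A →* G) (L : Language A)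
    (g : G) : Language (PaddedLetter A) :=
  {w | ∃ u ∈ L, ∃ v ∈ L,
    π (FreeMonoid.ofList v) = g * π (FreeMonoid.ofList u) ∧ w = convolution u v}

/-- `L` is an automatic structure for `π : A* → G`: it is a rational language that maps onto `G`,
and right multiplication by every `x ∈ A ∪ {1}` is recognized by a finite state automaton. -/
structure IsAutomaticStructure {A G : Type*} [Group G] (π : FreeMonoid A →* G)
    (L : Language A) : Prop where
  isRegular : L.IsRegular
  section_surjective : ∀ g : G, ∃ u ∈ L, π (FreeMonoid.ofList u) = g
  right_one : (rightMultiplierLanguage π L 1).IsRegular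
  right_letter : ∀ a : A, (rightMultiplierLanguage π L (π (FreeMonoid.of a))).IsRegular

/-- `L` is a biautomatic structure for `π : A* → G`: it is an automatic structure, and left
multiplication by every `x ∈ A ∪ {1}` is also recognized by a finite state automaton. -/
structure IsBiautomaticStructure {A G : Type*} [Group G] (π : FreeMonoid A →* G)
    (L : Language A) : Prop extends IsAutomaticStructure π L where
  left_one : (leftMultiplierLanguage π L 1).IsRegular
  left_letter : ∀ a : A, (leftMultiplierLanguage π L (π (FreeMonoid.of a))).IsRegular

/-- A group is biautomatic if it has a biautomatic structure for some surjective homomorphism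
`π : A* → G` with `A` a finite alphabet. -/
def IsBiautomatic (G : Type*) [Group G] : Prop :=
  ∃ (A : Type) (_ : Finite A) (π : FreeMonoid A →* G) (L : Language A),
    Function.Surjective π ∧ IsBiautomaticStructure π L

/-! For `u, v ∈ L` with `π v = g * π u * h`, regularity of these pairs is equivalent to finiteness
of the differences `u(n)⁻¹ g⁻¹ v(n)` of their prefixes. Finiteness composes, so it passes from
letters to all `g, h` (`IsBiautomaticStructure.fellowTravels`). If `u ∈ L` commutes with `s`, then
`u = s⁻¹ u s`: comparing `u` with itself leaves finitely many conjugates `w⁻¹ s w` over its prefixes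
`w`. An automaton can remember these, so the words of `L` in the centralizer form a regular
language. Finally, rational subgroups inherit biautomaticity by a Schreier rewriting along the
automaton (`IsBiautomatic.of_rational_subgroup`). -/

open FreeMonoid

/-! ### Padded words and their two tapes -/

namespace PaddedLetter

variable {A : Type*}

/-- The letter on the first tape. -/
def fst? : PaddedLetter A → Option A
  | both a _ => some a
  | left a => some a
  | right _ => none

/-- The letter on the second tape. -/
def snd? : PaddedLetter A → Option A
  | both _ b => some b
  | left _ => none
  | right b => some b

/-- The word on the first tape. -/
def fstWord (w : List (PaddedLetter A)) : List A := w.filterMap fst?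

/-- The word on the second tape. -/
def sndWord (w : List (PaddedLetter A)) : List A := w.filterMap snd?

theorem fstWord_append (w z : List (PaddedLetter A)) :
    fstWord (w ++ z) = fstWord w ++ fstWord z := List.filterMap_append

theorem sndWord_append (w z : List (PaddedLetter A)) :
    sndWord (w ++ z) = sndWord w ++ sndWord z := List.filterMap_append

theorem fstWord_take_convolution (u v : List A) (n : ℕ) :
    fstWord ((convolution u v).take n) = u.take n := by
  induction u, v using convolution.induct generalizing n <;> cases n <;>
    simp_all [convolution, fstWord, fst?, List.filterMap_cons, -List.filterMap_eq_nil_iff]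

theorem sndWord_take_convolution (u v : List A) (n : ℕ) :
    sndWord ((convolution u v).take n) = v.take n := by
  induction u, v using convolution.induct generalizing n <;> cases n <;>
    simp_all [convolution, sndWord, snd?, List.filterMap_cons, -List.filterMap_eq_nil_iff]

theorem fstWord_convolution (u v : List A) : fstWord (convolution u v) = u := by
  induction u, v using convolution.induct <;>
    simp_all [convolution, fstWord, fst?, List.filterMap_cons, -List.filterMap_eq_nil_iff]

theorem sndWord_convolution (u v : List A) : sndWord (convolution u v) = v := by
  induction u, v using convolution.induct <;>
    simp_all [convolution, sndWord, snd?, List.filterMap_cons, -List.filterMap_eq_nil_iff]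

end PaddedLetter

open PaddedLetter

/-- The language of all convolutions. -/
def convolutionLanguage (A : Type*) : Language (PaddedLetter A) :=
  {w | ∃ u v : List A, w = convolution u v}

theorem mem_convolutionLanguage_iff {A : Type*} {w : List (PaddedLetter A)} :
    w ∈ convolutionLanguage A ↔ convolution (fstWord w) (sndWord w) = w := by
  constructor
  · rintro ⟨u, v, rfl⟩
    rw [fstWord_convolution, sndWord_convolution]
  · exact fun h => ⟨_, _, h.symm⟩

theorem Language.leftQuotient_eq_zero_of_forall_notMem {α : Type*} {L : Language α} {w : List α}
    (h : ∀ z, w ++ z ∉ L) : L.leftQuotient w = 0 :=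
  Language.ext fun z => ⟨fun hz => (h z hz).elim, fun hz => (Language.notMem_zero z hz).elim⟩

/-- A language whose left quotients by single letters stay in a finite family that is closed under
such quotients is regular. -/
theorem Language.IsRegular.of_finite_closed {α : Type*} {F : Set (Language α)} (hF : F.Finite)
    (hstep : ∀ K ∈ F, ∀ x : α, K.leftQuotient [x] ∈ F) {L : Language α} (hL : L ∈ F) :
    L.IsRegular := by
  refine .of_finite_range_leftQuotient (hF.subset ?_)
  rintro _ ⟨w, rfl⟩
  induction w generalizing L with
  | nil => exact hL
  | cons x w ih =>
    rw [← List.singleton_append, Language.leftQuotient_append]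
    exact ih (hstep L hL x)

theorem convolutionLanguage_isRegular (A : Type*) : (convolutionLanguage A).IsRegular := by
  -- Once one tape has ended, only the other may continue.
  let Vl : Language (PaddedLetter A) := {w | ∃ u : List A, w = convolution u []}
  let Vr : Language (PaddedLetter A) := {w | ∃ v : List A, w = convolution [] v}
  refine Language.IsRegular.of_finite_closed (F := {convolutionLanguage A, Vl, Vr, 0})
    (by simp) ?_ (by simp)
  have mem_cons : ∀ (x : PaddedLetter A) (K : Language (PaddedLetter A)) z,
      z ∈ K.leftQuotient [x] ↔ x :: z ∈ K := fun _ _ _ => Iff.rfl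
  have hlb : ∀ a b z, both a b :: z ∉ Vl := by
    rintro a b z ⟨_ | ⟨c, u⟩, h⟩ <;> simp [convolution] at h
  have hlr : ∀ b z, right b :: z ∉ Vl := by
    rintro b z ⟨_ | ⟨c, u⟩, h⟩ <;> simp [convolution] at h
  have hrb : ∀ a b z, both a b :: z ∉ Vr := by
    rintro a b z ⟨_ | ⟨c, u⟩, h⟩ <;> simp [convolution] at h
  have hrl : ∀ b z, left b :: z ∉ Vr := by
    rintro b z ⟨_ | ⟨c, u⟩, h⟩ <;> simp [convolution] at h
  have hll : ∀ a z, left a :: z ∈ Vl ↔ z ∈ Vl := by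
    refine fun a z => ⟨?_, ?_⟩
    · rintro ⟨_ | ⟨c, u⟩, h⟩ <;> simp [convolution] at h
      exact ⟨u, h.2⟩
    · rintro ⟨u, rfl⟩
      exact ⟨a :: u, by simp [convolution]⟩
  have hrr : ∀ a z, right a :: z ∈ Vr ↔ z ∈ Vr := by
    refine fun a z => ⟨?_, ?_⟩
    · rintro ⟨_ | ⟨c, u⟩, h⟩ <;> simp [convolution] at h
      exact ⟨u, h.2⟩
    · rintro ⟨u, rfl⟩
      exact ⟨a :: u, by simp [convolution]⟩
  have hb : ∀ a b z, both a b :: z ∈ convolutionLanguage A ↔ z ∈ convolutionLanguage A := by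
    refine fun a b z => ⟨?_, ?_⟩
    · rintro ⟨_ | ⟨c, u⟩, _ | ⟨d, v⟩, h⟩ <;> simp [convolution] at h
      exact ⟨u, v, h.2⟩
    · rintro ⟨u, v, rfl⟩
      exact ⟨a :: u, b :: v, by simp [convolution]⟩
  have hl : ∀ a z, left a :: z ∈ convolutionLanguage A ↔ z ∈ Vl := by
    refine fun a z => ⟨?_, ?_⟩
    · rintro ⟨_ | ⟨c, u⟩, _ | ⟨d, v⟩, h⟩ <;> simp [convolution] at h
      exact ⟨u, h.2⟩
    · rintro ⟨u, rfl⟩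
      exact ⟨a :: u, [], by simp [convolution]⟩
  have hr : ∀ a z, right a :: z ∈ convolutionLanguage A ↔ z ∈ Vr := by
    refine fun a z => ⟨?_, ?_⟩
    · rintro ⟨_ | ⟨c, u⟩, _ | ⟨d, v⟩, h⟩ <;> simp [convolution] at h
      exact ⟨v, h.2⟩
    · rintro ⟨v, rfl⟩
      exact ⟨[], a :: v, by simp [convolution]⟩
  rintro K (rfl | rfl | rfl | rfl) (⟨a, b⟩ | a | b)
  · exact Or.inl (Language.ext (hb a b))
  · exact Or.inr (Or.inl (Language.ext (hl a)))
  · exact Or.inr (Or.inr (Or.inl (Language.ext (hr b))))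
  · exact Or.inr (Or.inr (Or.inr (Language.leftQuotient_eq_zero_of_forall_notMem (hlb a b))))
  · exact Or.inr (Or.inl (Language.ext (hll a)))
  · exact Or.inr (Or.inr (Or.inr (Language.leftQuotient_eq_zero_of_forall_notMem (hlr b))))
  · exact Or.inr (Or.inr (Or.inr (Language.leftQuotient_eq_zero_of_forall_notMem (hrb a b))))
  · exact Or.inr (Or.inr (Or.inr (Language.leftQuotient_eq_zero_of_forall_notMem (hrl a))))
  · exact Or.inr (Or.inr (Or.inl (Language.ext (hrr b))))
  all_goals
    exact Or.inr (Or.inr (Or.inr (Language.leftQuotient_eq_zero_of_forall_notMem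
      fun z => Language.notMem_zero _)))

/-! ### Regularity and fellow travelling -/

section Multiplier

variable {A G : Type*} [Group G]

/-- The language `{u ⋄ v | u, v ∈ L, π v = g * π u * h}`. -/
def twoSidedMultiplierLanguage (π : FreeMonoid A →* G) (L : Language A) (g h : G) :
    Language (PaddedLetter A) :=
  {w | ∃ u ∈ L, ∃ v ∈ L, π (ofList v) = g * π (ofList u) * h ∧ w = convolution u v}

theorem rightMultiplierLanguage_eq (π : FreeMonoid A →* G) (L : Language A) (h : G) :
    rightMultiplierLanguage π L h = twoSidedMultiplierLanguage π L 1 h := by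
  simp [rightMultiplierLanguage, twoSidedMultiplierLanguage]
  rfl

theorem leftMultiplierLanguage_eq (π : FreeMonoid A →* G) (L : Language A) (g : G) :
    leftMultiplierLanguage π L g = twoSidedMultiplierLanguage π L g 1 := by
  simp [leftMultiplierLanguage, twoSidedMultiplierLanguage]
  rfl

theorem mem_twoSidedMultiplierLanguage_iff {π : FreeMonoid A →* G} {L : Language A} {g h : G}
    {w : List (PaddedLetter A)} :
    w ∈ twoSidedMultiplierLanguage π L g h ↔
      w ∈ convolutionLanguage A ∧ fstWord w ∈ L ∧ sndWord w ∈ L ∧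
        π (ofList (sndWord w)) = g * π (ofList (fstWord w)) * h := by
  constructor
  · rintro ⟨u, hu, v, hv, huv, rfl⟩
    rw [fstWord_convolution, sndWord_convolution]
    exact ⟨⟨u, v, rfl⟩, hu, hv, huv⟩
  · rintro ⟨hw, hu, hv, huv⟩
    exact ⟨_, hu, _, hv, huv, (mem_convolutionLanguage_iff.1 hw).symm⟩

/-- Words `u, v ∈ L` with `π v = g * π u * h` have only finitely many word differences, when the
path of `v` starts at `1` and the path of `u` starts at `g`. -/
def FellowTravels (π : FreeMonoid A →* G) (L : Language A) (g h : G) : Prop :=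
  ∃ D : Set G, D.Finite ∧ ∀ u ∈ L, ∀ v ∈ L, π (ofList v) = g * π (ofList u) * h →
    ∀ n : ℕ, (π (ofList (u.take n)))⁻¹ * g⁻¹ * π (ofList (v.take n)) ∈ D

/-- The difference after a prefix depends only on the state reached: any completion `z` accepted
from that state forces it to be `z₁ h z₂⁻¹`, with `z₁, z₂` the tapes of `z`. -/
theorem FellowTravels.of_isRegular {π : FreeMonoid A →* G} {L : Language A} {g h : G}
    (hreg : (twoSidedMultiplierLanguage π L g h).IsRegular) : FellowTravels π L g h := by
  obtain ⟨σ, _, M, hM⟩ := hreg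
  have key : ∀ s : σ, ∃ d : G, ∀ x, M.eval x = s →
      (∃ z, x ++ z ∈ twoSidedMultiplierLanguage π L g h) →
      (π (ofList (fstWord x)))⁻¹ * g⁻¹ * π (ofList (sndWord x)) = d := by
    intro s
    by_cases hs : ∃ z, M.evalFrom s z ∈ M.accept
    · obtain ⟨z, hz⟩ := hs
      refine ⟨π (ofList (fstWord z)) * h * (π (ofList (sndWord z)))⁻¹, fun x hx _ => ?_⟩
      have hxz : x ++ z ∈ twoSidedMultiplierLanguage π L g h := by
        rw [← hM, DFA.mem_accepts, DFA.eval, DFA.evalFrom_of_append]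
        rw [DFA.eval] at hx
        rwa [hx]
      have e := (mem_twoSidedMultiplierLanguage_iff.1 hxz).2.2.2
      rw [fstWord_append, sndWord_append, ofList_append, ofList_append, map_mul, map_mul] at e
      rw [eq_mul_inv_iff_mul_eq, mul_assoc, e]
      group
    · refine ⟨1, fun x hx ⟨z, hxz⟩ => (hs ⟨z, ?_⟩).elim⟩
      rw [← hM, DFA.mem_accepts, DFA.eval, DFA.evalFrom_of_append] at hxz
      rw [DFA.eval] at hx
      rwa [hx] at hxz
  choose d hd using key
  refine ⟨Set.range d, Set.finite_range d, fun u hu v hv huv n => ?_⟩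
  rw [← fstWord_take_convolution u v, ← sndWord_take_convolution u v]
  refine ⟨_, (hd _ _ rfl ⟨(convolution u v).drop n, ?_⟩).symm⟩
  rw [List.take_append_drop]
  exact ⟨u, hu, v, hv, huv, rfl⟩

/-- A nonempty left quotient is determined by the quotients of `L` on each tape, the quotient of the
convolutions, and the current difference in `D`. -/
theorem FellowTravels.isRegular {π : FreeMonoid A →* G} {L : Language A} {g h : G}
    (hL : L.IsRegular) (hD : FellowTravels π L g h) :
    (twoSidedMultiplierLanguage π L g h).IsRegular := by
  obtain ⟨D, hDfin, hD⟩ := hD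
  let Φ : Language A × Language A × Language (PaddedLetter A) × G → Language (PaddedLetter A) :=
    fun p => {z | fstWord z ∈ p.1 ∧ sndWord z ∈ p.2.1 ∧ z ∈ p.2.2.1 ∧
      p.2.2.2 * π (ofList (sndWord z)) = π (ofList (fstWord z)) * h}
  have hfin := ((hL.finite_range_leftQuotient.prod (hL.finite_range_leftQuotient.prod
    ((convolutionLanguage_isRegular A).finite_range_leftQuotient.prod hDfin))).image Φ).insert 0
  refine .of_finite_range_leftQuotient (hfin.subset ?_)
  rintro _ ⟨w, rfl⟩
  by_cases hw : ∃ z, w ++ z ∈ twoSidedMultiplierLanguage π L g h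
  · refine Or.inr ⟨(L.leftQuotient (fstWord w), L.leftQuotient (sndWord w),
      (convolutionLanguage A).leftQuotient w,
      (π (ofList (fstWord w)))⁻¹ * g⁻¹ * π (ofList (sndWord w))),
      ⟨⟨_, rfl⟩, ⟨_, rfl⟩, ⟨_, rfl⟩, ?_⟩, ?_⟩
    · obtain ⟨z, u, hu, v, hv, huv, e⟩ := hw
      have hw : w = (convolution u v).take w.length := by rw [← e, List.take_left]
      have := hD u hu v hv huv w.length
      rwa [← fstWord_take_convolution u v, ← sndWord_take_convolution u v, ← hw] at this
    · refine Language.ext fun z => ?_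
      rw [Language.mem_leftQuotient, mem_twoSidedMultiplierLanguage_iff, fstWord_append,
        sndWord_append, ofList_append, ofList_append, map_mul, map_mul]
      have e : (π (ofList (fstWord w)))⁻¹ * g⁻¹ * π (ofList (sndWord w)) * π (ofList (sndWord z)) =
          π (ofList (fstWord z)) * h ↔ π (ofList (sndWord w)) * π (ofList (sndWord z)) =
          g * (π (ofList (fstWord w)) * π (ofList (fstWord z))) * h := by
        rw [← mul_inv_rev, mul_assoc, inv_mul_eq_iff_eq_mul]
        simp only [mul_assoc]
      constructor
      · rintro ⟨h1, h2, h3, h4⟩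
        exact ⟨h3, h1, h2, e.1 h4⟩
      · rintro ⟨h1, h2, h3, h4⟩
        exact ⟨h2, h3, h1, e.2 h4⟩
  · exact Or.inl (Language.leftQuotient_eq_zero_of_forall_notMem (not_exists.1 hw))

/-- Interpolate a word `w ∈ L` for `g₁ * π u * h₁`; the differences of `(u, w)` and `(w, v)`
multiply to that of `(u, v)`. -/
theorem FellowTravels.mul {π : FreeMonoid A →* G} {L : Language A}
    (hL : ∀ g : G, ∃ u ∈ L, π (ofList u) = g) {g₁ h₁ g₂ h₂ : G}
    (H₁ : FellowTravels π L g₁ h₁) (H₂ : FellowTravels π L g₂ h₂) :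
    FellowTravels π L (g₂ * g₁) (h₁ * h₂) := by
  obtain ⟨D₁, hf₁, hD₁⟩ := H₁
  obtain ⟨D₂, hf₂, hD₂⟩ := H₂
  refine ⟨Set.image2 (· * ·) D₁ D₂, hf₁.image2 _ hf₂, fun u hu v hv huv n => ?_⟩
  obtain ⟨w, hw, huw⟩ := hL (g₁ * π (ofList u) * h₁)
  refine ⟨_, hD₁ u hu w hw huw n, _, hD₂ w hw v hv ?_ n, ?_⟩
  · rw [huv, huw]
    simp only [mul_assoc]
  · group

theorem IsBiautomaticStructure.fellowTravels {π : FreeMonoid A →* G} {L : Language A}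
    (hπ : Function.Surjective π) (hL : IsBiautomaticStructure π L) (g h : G) :
    FellowTravels π L g h := by
  have hone : FellowTravels π L 1 1 :=
    .of_isRegular (rightMultiplierLanguage_eq π L 1 ▸ hL.right_one)
  have hright : ∀ h, FellowTravels π L 1 h := by
    intro h
    obtain ⟨w, rfl⟩ := hπ h
    induction w using FreeMonoid.inductionOn' with
    | one => rwa [map_one]
    | of_mul a w ih =>
      have ha : FellowTravels π L 1 (π (of a)) :=
        .of_isRegular (rightMultiplierLanguage_eq π L _ ▸ hL.right_letter a)
      simpa using ha.mul hL.section_surjective ih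
  have hleft : ∀ g, FellowTravels π L g 1 := by
    intro g
    obtain ⟨w, rfl⟩ := hπ g
    induction w using FreeMonoid.inductionOn' with
    | one => rwa [map_one]
    | of_mul a w ih =>
      have ha : FellowTravels π L (π (of a)) 1 :=
        .of_isRegular (leftMultiplierLanguage_eq π L _ ▸ hL.left_letter a)
      simpa using ih.mul hL.section_surjective ha
  simpa using (hleft g).mul hL.section_surjective (hright h)

theorem IsBiautomaticStructure.of_fellowTravels {π : FreeMonoid A →* G} {L : Language A}
    (hreg : L.IsRegular) (hsurj : ∀ g : G, ∃ u ∈ L, π (ofList u) = g)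
    (hD : ∀ g h, FellowTravels π L g h) : IsBiautomaticStructure π L where
  isRegular := hreg
  section_surjective := hsurj
  right_one := rightMultiplierLanguage_eq π L 1 ▸ (hD _ _).isRegular hreg
  right_letter a := rightMultiplierLanguage_eq π L (π (of a)) ▸ (hD _ _).isRegular hreg
  left_one := leftMultiplierLanguage_eq π L 1 ▸ (hD _ _).isRegular hreg
  left_letter a := leftMultiplierLanguage_eq π L (π (of a)) ▸ (hD _ _).isRegular hreg

/-- The part of `L` that represents elements of a subgroup. -/
def subgroupLanguage (π : FreeMonoid A →* G) (L : Language A) (H : Subgroup G) : Language A :=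
  {u | u ∈ L ∧ π (ofList u) ∈ H}

/-- The centralizer of a finite set is a rational subgroup. -/
theorem subgroupLanguage_centralizer_isRegular {π : FreeMonoid A →* G} {L : Language A}
    (hL : L.IsRegular) (hD : ∀ g h, FellowTravels π L g h) {S : Set G} (hS : S.Finite) :
    (subgroupLanguage π L (Subgroup.centralizer S)).IsRegular := by
  have := hS.to_subtype
  -- With multipliers `s⁻¹, s`, a word commuting with `s` is paired with itself.
  choose D hDfin hD using fun s : S => hD (s : G)⁻¹ s
  let Φ : Language A × (S → G) → Language A :=
    fun p => {z | z ∈ p.1 ∧ ∀ s : S, p.2 s * π (ofList z) = π (ofList z) * s}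
  have hfin := ((hL.finite_range_leftQuotient.prod (Set.Finite.pi' hDfin)).image Φ).insert 0
  refine .of_finite_range_leftQuotient (hfin.subset ?_)
  rintro _ ⟨w, rfl⟩
  by_cases hw : ∃ z, w ++ z ∈ subgroupLanguage π L (Subgroup.centralizer S)
  · refine Or.inr ⟨(L.leftQuotient w, fun s => (π (ofList w))⁻¹ * s * π (ofList w)),
      ⟨⟨_, rfl⟩, fun s => ?_⟩, Language.ext fun z => ?_⟩
    · obtain ⟨z, hz, hzc⟩ := hw
      have := hD s _ hz _ hz ?_ w.length
      · simpa using this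
      · rw [mul_assoc, eq_inv_mul_iff_mul_eq]
        exact Subgroup.mem_centralizer_iff.1 hzc s s.2
    · refine and_congr Iff.rfl ?_
      rw [Subgroup.mem_centralizer_iff, ofList_append, map_mul]
      constructor
      · intro h s hs
        have := h ⟨s, hs⟩
        dsimp only at this
        rw [mul_assoc, mul_assoc, inv_mul_eq_iff_eq_mul] at this
        rw [this, mul_assoc]
      · intro h s
        dsimp only
        rw [mul_assoc, mul_assoc, inv_mul_eq_iff_eq_mul, h s s.2, mul_assoc]
  · exact Or.inl (Language.leftQuotient_eq_zero_of_forall_notMem (not_exists.1 hw))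

end Multiplier

/-! ### Accepting runs as words -/

namespace DFA

variable {A σ : Type*}

/-- The run of `M` on a word, starting at a state `q`: each letter is recorded together with the
state in which it is read. -/
def run (M : DFA A σ) : σ → List A → List (σ × A)
  | _, [] => []
  | q, a :: u => (q, a) :: run M (M.step q a) u

theorem run_append (M : DFA A σ) (q : σ) (u v : List A) :
    M.run q (u ++ v) = M.run q u ++ M.run (M.evalFrom q u) v := by
  induction u generalizing q with
  | nil => rfl
  | cons a u ih => simp [run, ih]

theorem run_take (M : DFA A σ) (q : σ) (u : List A) (n : ℕ) :
    (M.run q u).take n = M.run q (u.take n) := by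
  induction u generalizing q n with
  | nil => simp [run]
  | cons a u ih => cases n <;> simp [run, ih]

theorem map_snd_run (M : DFA A σ) (q : σ) (u : List A) : (M.run q u).map Prod.snd = u := by
  induction u generalizing q with
  | nil => rfl
  | cons a u ih => simp [run, ih]

/-- The language of accepting runs of `M`. -/
def runLanguage (M : DFA A σ) : Language (σ × A) := M.run M.start '' M.accepts

theorem runLanguage_isRegular [Finite σ] (M : DFA A σ) : M.runLanguage.IsRegular := by
  let Φ : σ → Language (σ × A) := fun q => M.run q '' M.acceptsFrom q
  refine .of_finite_range_leftQuotient (((Set.finite_range Φ).insert 0).subset ?_)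
  rintro _ ⟨w, rfl⟩
  by_cases hw : ∃ z, w ++ z ∈ M.runLanguage
  · obtain ⟨z, u, hu, huz⟩ := hw
    have hw : w = M.run M.start (u.take w.length) := by rw [← run_take, huz, List.take_left]
    generalize u.take w.length = x at hw
    subst hw
    refine Or.inr ⟨M.eval x, Language.ext fun z => ?_⟩
    constructor
    · rintro ⟨y, hy, rfl⟩
      refine ⟨x ++ y, ?_, run_append M _ _ _⟩
      change M.evalFrom _ _ ∈ M.accept
      rwa [evalFrom_of_append]
    · rintro ⟨v, hv, hvz⟩
      -- A run records its letters, so `v` must begin with `x`.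
      have hx : v.take x.length = x := by
        have hlen : (M.run M.start x).length = x.length := by
          conv_rhs => rw [← map_snd_run M M.start x, List.length_map]
        have h1 := congrArg (fun l => (l.map Prod.snd).take x.length) hvz
        simpa [map_snd_run] using h1
      obtain ⟨y, rfl⟩ : ∃ y, x ++ y = v := ⟨v.drop x.length, by
        conv_rhs => rw [← List.take_append_drop x.length v, hx]⟩
      rw [run_append] at hvz
      refine ⟨y, ?_, List.append_cancel_left hvz⟩
      change M.evalFrom _ _ ∈ M.accept at hv
      rwa [evalFrom_of_append] at hv
  · exact Or.inl (Language.leftQuotient_eq_zero_of_forall_notMem (not_exists.1 hw))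

end DFA

/-- Rational subgroups of biautomatic groups are biautomatic. -/
theorem IsBiautomatic.of_rational_subgroup {A : Type} [Finite A] {G : Type*} [Group G]
    {π : FreeMonoid A →* G} {L : Language A}
    (hsurj : ∀ g : G, ∃ u ∈ L, π (ofList u) = g) (hD : ∀ g h, FellowTravels π L g h)
    (H : Subgroup G) (hH : (subgroupLanguage π L H).IsRegular) : IsBiautomatic H := by
  classical
  obtain ⟨σ, _, M, hM⟩ := hH
  have acc : ∀ {u}, u ∈ M.accepts ↔ u ∈ L ∧ π (ofList u) ∈ H := fun {u} => by rw [hM]; rfl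
  -- Live prefixes reaching `q` share a completion into `H`, hence lie in one coset `H * t`; the
  -- coset `H` itself gets representative `1`.
  have key : ∀ q : σ, ∃ t : G, (∀ w, M.eval w = q → (∃ z, w ++ z ∈ M.accepts) →
      π (ofList w) * t⁻¹ ∈ H) ∧ (t ∈ H → t = 1) := by
    intro q
    by_cases hq : ∃ w, M.eval w = q ∧ ∃ z, w ++ z ∈ M.accepts
    · obtain ⟨w, hw, z, hz⟩ := hq
      have main : ∀ x, M.eval x = q → π (ofList x) * (π (ofList w))⁻¹ ∈ H := by
        intro x hx
        have hxz : x ++ z ∈ M.accepts := by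
          rw [DFA.mem_accepts, DFA.eval, DFA.evalFrom_of_append] at hz ⊢
          rw [DFA.eval] at hx hw
          rwa [hx, ← hw]
        have := H.mul_mem (acc.1 hxz).2 (H.inv_mem (acc.1 hz).2)
        simpa [ofList_append] using this
      by_cases hwH : π (ofList w) ∈ H
      · refine ⟨1, fun x hx _ => ?_, fun _ => rfl⟩
        simpa using H.mul_mem (main x hx) hwH
      · exact ⟨π (ofList w), fun x hx _ => main x hx, fun h => (hwH h).elim⟩
    · exact ⟨1, fun w hw hz => (hq ⟨w, hw, hz⟩).elim, fun _ => rfl⟩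
  choose t ht ht1 using key
  have t_eq_one : ∀ w, (∃ z, w ++ z ∈ M.accepts) → π (ofList w) ∈ H → t (M.eval w) = 1 :=
    fun w hz hw => ht1 _ (by simpa using H.mul_mem (H.inv_mem (ht _ w rfl hz)) hw)
  have t_start : t M.start = 1 := by
    obtain ⟨u, hu, hu1⟩ := hsurj 1
    exact t_eq_one [] ⟨u, acc.2 ⟨hu, hu1 ▸ H.one_mem⟩⟩ (by simp)
  -- Schreier generators, which telescope along runs; letters whose value leaves `H` get the junk
  -- value `1` and occur in no accepting run.
  let ψ : FreeMonoid (σ × A) →* H := FreeMonoid.lift fun p =>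
    if h : t p.1 * π (of p.2) * (t (M.step p.1 p.2))⁻¹ ∈ H then ⟨_, h⟩ else 1
  have ψ_run : ∀ x, (∃ z, x ++ z ∈ M.accepts) →
      (ψ (ofList (M.run M.start x)) : G) = π (ofList x) * (t (M.eval x))⁻¹ := by
    intro x
    induction x using List.reverseRecOn with
    | nil => simp [DFA.run, t_start]
    | append_singleton x a ih =>
      rintro ⟨z, hz⟩
      have hx : ∃ z, x ++ z ∈ M.accepts := ⟨[a] ++ z, by rwa [← List.append_assoc]⟩
      have hmem : t (M.eval x) * π (of a) * (t (M.step (M.eval x) a))⁻¹ ∈ H := by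
        have := H.mul_mem (H.inv_mem (ht _ x rfl hx)) (ht _ (x ++ [a]) rfl ⟨z, hz⟩)
        rw [DFA.eval_append_singleton, ofList_append, map_mul, ofList_singleton] at this
        simpa [mul_assoc] using this
      have hlast : (ψ (of (M.eval x, a)) : G) =
          t (M.eval x) * π (of a) * (t (M.step (M.eval x) a))⁻¹ := by
        simp only [ψ, lift_eval_of]
        rw [dif_pos hmem]
      rw [DFA.run_append, ofList_append, map_mul, Subgroup.coe_mul, ih hx, ofList_append, map_mul,
        ofList_singleton, DFA.eval_append_singleton]
      change _ * (ψ (of (M.eval x, a)) : G) = _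
      rw [hlast]
      group
  have ψ_accept : ∀ u ∈ M.accepts, (ψ (ofList (M.run M.start u)) : G) = π (ofList u) := by
    intro u hu
    have hu' : ∃ z, u ++ z ∈ M.accepts := ⟨[], by simpa using hu⟩
    rw [ψ_run u hu', t_eq_one u hu' (acc.1 hu).2, inv_one, mul_one]
  have hsec : ∀ g : H, ∃ u ∈ M.runLanguage, ψ (ofList u) = g := by
    intro g
    obtain ⟨u, hu, hug⟩ := hsurj g
    have hu : u ∈ M.accepts := acc.2 ⟨hu, hug ▸ g.2⟩
    exact ⟨_, ⟨u, hu, rfl⟩, Subtype.ext ((ψ_accept u hu).trans hug)⟩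
  refine ⟨σ × A, inferInstance, ψ, M.runLanguage, fun g => ?_,
    .of_fellowTravels M.runLanguage_isRegular hsec fun g h => ?_⟩
  · obtain ⟨u, -, hu⟩ := hsec g
    exact ⟨_, hu⟩
  · obtain ⟨D, hDfin, hD⟩ := hD g h
    -- Rewriting changes a difference `d` only by the representatives of the two current states.
    have hfin : (Set.image2 (fun (p : σ × σ) d => t p.1 * d * (t p.2)⁻¹) Set.univ D).Finite :=
      Set.finite_univ.image2 _ hDfin
    refine ⟨_, hfin.preimage (f := ((↑) : H → G)) Subtype.val_injective.injOn, ?_⟩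
    rintro _ ⟨u, hu, rfl⟩ _ ⟨v, hv, rfl⟩ huv n
    have huv' : π (ofList v) = g * π (ofList u) * h := by
      rw [← ψ_accept u hu, ← ψ_accept v hv, huv]
      rfl
    refine ⟨(M.eval (u.take n), M.eval (v.take n)), trivial, _,
      hD u (acc.1 hu).1 v (acc.1 hv).1 huv' n, ?_⟩
    have hu' : ∃ z, u.take n ++ z ∈ M.accepts := ⟨u.drop n, by rwa [List.take_append_drop]⟩
    have hv' : ∃ z, v.take n ++ z ∈ M.accepts := ⟨v.drop n, by rwa [List.take_append_drop]⟩
    rw [DFA.run_take, DFA.run_take, Subgroup.coe_mul, Subgroup.coe_mul, Subgroup.coe_inv,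
      Subgroup.coe_inv, ψ_run _ hu', ψ_run _ hv']
    group

theorem corollary5p10 {G : Type*} [Group G] (hG : IsBiautomatic G) (S : Set G) (hS : S.Finite) :
    IsBiautomatic (Subgroup.centralizer S) := by
  obtain ⟨A, _, π, L, hπ, hL⟩ := hG
  have hD := hL.fellowTravels hπ
  exact .of_rational_subgroup hL.section_surjective hD _
    (subgroupLanguage_centralizer_isRegular hL.isRegular hD hS)
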